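/- Let $\mathfrak g$ be a finite-dimensional real solvable Lie algebra whose nilradical $\mathfrak h$ (the greatest ideal that is nilpotent as a Lie algebra) has codimension $2$. Let $d$ denote the Chevalley–Eilenberg differential on alternating forms on $\mathfrak g$, $d\alpha(X_0,\dots,X_k)=\sum_{i<j}(-1)^{i+j}\alpha([X_i,X_j],X_0,\dots,\widehat{X_i},\dots,\widehat{X_j},\dots,X_k)$. A Hermitian structure $(J,\langle\cdot,\cdot\rangle)$ on $\mathfrak g$ is a linear map $J:\mathfrak g\to\mathfrak g$ with $J^2=-\mathrm{id}$ and vanishing Nijenhuis tensor $[X,Y]+J([JX,Y]+[X,JY])-[JX,JY]$, together with a positive definite inner product such that $\langle JX,JY\rangle=\langle X,Y\rangle$. Its fundamental form is $\omega(X,Y)=\langle JX,Y\rangle$ and its Bismut torsion is the $3$-form $c(X,Y,Z)=d\omega(JX,JY,JZ)$. It is Kähler if $d\omega=0$. A generalized Kähler structure $(J_\pm,\langle\cdot,\cdot\rangle)$ is a pair of Hermitian structures $(J_+,\langle\cdot,\cdot\rangle)$, $(J_-,\langle\cdot,\cdot\rangle)$ with the same inner product whose Bismut torsions satisfy $c_+=-c_-$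 and $dc_+=0$. The following are equivalent: (i) $\mathfrak g$ admits a generalized Kähler structure $(J_\pm,\langle\cdot,\cdot\rangle)$ such that $J_+\mathfrak h=\mathfrak h$ and $J_-\mathfrak h=\mathfrak h$; (ii) $\mathfrak g$ admits a Kähler structure $(J_+,\langle\cdot,\cdot\rangle)$ such that $J_+\mathfrak h=\mathfrak h$. Moreover, the equivalence holds with the same $J_+$ and $\langle\cdot,\cdot\rangle$: given a linear map $J_+$ and a bilinear form $\langle\cdot,\cdot\rangle$ on $\mathfrak g$, there is a $J_-$ such that $(J_\pm,\langle\cdot,\cdot\rangle)$ is as in (i) if and only if $(J_+,\langle\cdot,\cdot\rangle)$ is as in (ii). -/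

import Mathlib

namespace LieHermitian

variable {g : Type*} [LieRing g] [LieAlgebra ℝ g]

/-- `h` is the nilradical of `g`: the greatest ideal of `g` that is nilpotent as a Lie algebra.
(Mathlib's `LieAlgebra.maxNilpotentIdeal` is something else: it asks that the ideal be nilpotent
as a module over `g`.) -/
def IsNilradical (h : LieIdeal ℝ g) : Prop :=
  IsGreatest {I : LieIdeal ℝ g | LieRing.IsNilpotent I} h

/-- The Chevalley–Eilenberg differential of a 2-form:
`(dα)(x₀, x₁, x₂) = ∑_{i < j} (-1)^(i + j) α([xᵢ, xⱼ], xₖ)`. -/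
def extDeriv₂ (α : g → g → ℝ) (x y z : g) : ℝ :=
  -α ⁅x, y⁆ z + α ⁅x, z⁆ y - α ⁅y, z⁆ x

/-- The Chevalley–Eilenberg differential of a 3-form:
`(dγ)(x₀, x₁, x₂, x₃) = ∑_{i < j} (-1)^(i + j) γ([xᵢ, xⱼ], xₖ, xₗ)`,
where `k < l` are the two remaining indices. -/
def extDeriv₃ (γ : g → g → g → ℝ) (w x y z : g) : ℝ :=
  -γ ⁅w, x⁆ y z + γ ⁅w, y⁆ x z - γ ⁅w, z⁆ x y
    - γ ⁅x, y⁆ w z + γ ⁅x, z⁆ w y - γ ⁅y, z⁆ w x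

/-- `J` is an (integrable) complex structure on the Lie algebra `g`: `J² = -1` and the
Nijenhuis tensor `N(x, y) = [x, y] + J([Jx, y] + [x, Jy]) - [Jx, Jy]` vanishes. -/
structure IsComplexStructure (J : g →ₗ[ℝ] g) : Prop where
  sq_eq_neg : ∀ x, J (J x) = -x
  integrable : ∀ x y, ⁅x, y⁆ + J (⁅J x, y⁆ + ⁅x, J y⁆) - ⁅J x, J y⁆ = 0

/-- `(J, B)` is a Hermitian structure on `g`: `J` is a complex structure and `B` is a
(positive definite) inner product for which `J` is orthogonal. -/
structure IsHermitian (J : g →ₗ[ℝ] g) (B : LinearMap.BilinForm ℝ g) : Prop where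
  complex : IsComplexStructure J
  symm : ∀ x y, B x y = B y x
  pos : ∀ x, x ≠ 0 → 0 < B x x
  compatible : ∀ x y, B (J x) (J y) = B x y

/-- The fundamental form `ω(x, y) = ⟨Jx, y⟩`. -/
def fundamentalForm (J : g →ₗ[ℝ] g) (B : LinearMap.BilinForm ℝ g) (x y : g) : ℝ :=
  B (J x) y

/-- The Bismut torsion 3-form `c(x, y, z) = dω(Jx, Jy, Jz)`. -/
def bismutTorsion (J : g →ₗ[ℝ] g) (B : LinearMap.BilinForm ℝ g) (x y z : g) : ℝ :=
  extDeriv₂ (fundamentalForm J B) (J x) (J y) (J z)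

/-- `(J, B)` is a Kähler structure on `g`: it is Hermitian and `dω = 0`. -/
structure IsKahler (J : g →ₗ[ℝ] g) (B : LinearMap.BilinForm ℝ g) : Prop where
  hermitian : IsHermitian J B
  closed : ∀ x y z, extDeriv₂ (fundamentalForm J B) x y z = 0

/-- `(J₊, J₋, B)` is a generalized Kähler structure on `g`: both `(J₊, B)` and `(J₋, B)` are
Hermitian, and their Bismut torsions satisfy `c₊ = -c₋` and `dc₊ = 0`. -/
structure IsGeneralizedKahler (Jp Jm : g →ₗ[ℝ] g) (B : LinearMap.BilinForm ℝ g) : Prop where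
  hermitian_plus : IsHermitian Jp B
  hermitian_minus : IsHermitian Jm B
  torsion_eq_neg : ∀ x y z, bismutTorsion Jp B x y z = -bismutTorsion Jm B x y z
  torsion_closed : ∀ w x y z, extDeriv₃ (bismutTorsion Jp B) w x y z = 0

/-- The subspace underlying the ideal `h` satisfies `J h = h`. -/
def Preserves (J : g →ₗ[ℝ] g) (h : LieIdeal ℝ g) : Prop :=
  h.toSubmodule.map J = h.toSubmodule

end LieHermitian

/-!
A Kähler structure is generalized Kähler with `J₋ = J₊`. Conversely, suppose that `(J₊, J₋)` is
generalized Kähler and that both complex structures preserve the nilradical `h`.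

The structure restricts to `h`, and a nilpotent Lie algebra `n` with a generalized Kähler structure
is abelian (`IsGeneralizedKahler.lie_eq_zero`). To see this, let `H = c₊` and consider the Courant
algebra `n ⊕ n*` twisted by `H`. It is a nilpotent Lie algebra with an invariant form, positive on
the vectors `x⁺ = x + ⟨x, ·⟩` and negative on `x⁻ = x - ⟨x, ·⟩`. Let `U` and `V` be the components
of its structure tensor on `x⁺, y⁺, z⁺` and on `x⁺, y⁺, z⁻`. Integrability of `J₊` says that `U` has
no `(3, 0)`-part (`IsHermitian.cyclicForm_type`), and that `V` is of type `(1, 1)` in `x, y`, that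
is, that the Bismut connection preserves `J₊` (`IsHermitian.bismut_connection`). The map which is
`J₊` on the `x⁺` and `J₋` on the `x⁻` is an integrable complex structure on the Courant algebra
(`generalizedComplex_courantAd`). In a nilpotent Lie algebra, `(1, 0)`-vectors act on
`(1, 0)`-vectors by nilpotent maps, so the traces of these actions vanish; on the Courant algebra
this gives `∑ [eₖ, J₊ eₖ] = 0` over an orthonormal basis (`sum_bilin_lie_eq_zero`). Contracting the
Jacobi identity of the Courant algebra (`courant_bianchi`) with `J₊` then leaves `|U|² = 3 |V|²`,
while the vanishing of the Killing form of `n` (`sum_structure_constants_eq_zero`) turns this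
equality into `6 |[·, ·]|² + 2 |H|² = 0`.

So `h` is abelian. Let `e₁` be orthogonal to `h` and `e₂ = J₊ e₁`. Then `[e₁, e₂]` lies in `h`, as
otherwise it would act nilpotently on `h` and generate with `h` a larger nilpotent ideal
(`IsNilradical.lie_mem_of_codim_two`). Both `c₊` and `c₋` take the value `-⟨[e₁, e₂], z⟩` on
`e₁, e₂, z` for `z` in `h`, and they are opposite, so `[e₁, e₂] = 0`. The sum of
`dc₊(e₁, e₂, fₖ, J₊ fₖ)` over an orthonormal basis of `h` is, up to sign, the sum of the squared
norms of `c₊(e₁, ·, ·)` and `c₊(e₂, ·, ·)` on `h` (`sum_sq_skewPart`). Hence `c₊ = 0`, which is the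
Kähler condition (`IsGeneralizedKahler.isKahler`).
-/

namespace LieHermitian

open Module

/-! ### Sums over orthonormal bases and traces -/

section LinearAlgebra

variable {V : Type*} [AddCommGroup V] [Module ℝ V] {ι : Type*} [Fintype ι] [DecidableEq ι]

theorem exists_orthonormal_basis [FiniteDimensional ℝ V] {B : LinearMap.BilinForm ℝ V}
    (symm : ∀ x y, B x y = B y x) (pos : ∀ x, x ≠ 0 → 0 < B x x) :
    ∃ e : Basis (Fin (finrank ℝ V)) ℝ V, ∀ i j, B (e i) (e j) = if i = j then 1 else 0 := by
  let core : InnerProductSpace.Core ℝ V :=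
    { inner := fun x y => B x y
      conj_inner_symm := fun x y => symm y x
      re_inner_nonneg := fun x => by
        by_cases hx : x = 0
        · simp [hx]
        · exact (pos x hx).le
      add_left := fun x y z => by simp
      smul_left := fun x y r => by simp
      definite := fun x hx => by
        by_contra hne
        exact (pos x hne).ne' hx }
  let _ : NormedAddCommGroup V := core.toNormedAddCommGroup
  let _ : InnerProductSpace ℝ V := InnerProductSpace.ofCore core.toCore
  let b := stdOrthonormalBasis ℝ V
  refine ⟨b.toBasis, fun i j => ?_⟩
  have := orthonormal_iff_ite.mp b.orthonormal i j
  rw [b.coe_toBasis]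
  exact this

variable {B : LinearMap.BilinForm ℝ V} {e : Basis ι ℝ V}

theorem repr_eq_of_orthonormal (he : ∀ i j, B (e i) (e j) = if i = j then 1 else 0)
    (x : V) (k : ι) : e.repr x k = B x (e k) := by
  conv_rhs => rw [← e.sum_repr x]
  simp only [map_sum, map_smul, LinearMap.sum_apply, LinearMap.smul_apply, he, smul_eq_mul]
  simp

theorem sum_bilin_mul_of_orthonormal (he : ∀ i j, B (e i) (e j) = if i = j then 1 else 0)
    (l : V →ₗ[ℝ] ℝ) (x : V) : ∑ k, B x (e k) * l (e k) = l x := by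
  conv_rhs => rw [← e.sum_repr x]
  simp [repr_eq_of_orthonormal he]

theorem trace_eq_sum_of_orthonormal (he : ∀ i j, B (e i) (e j) = if i = j then 1 else 0)
    (f : V →ₗ[ℝ] V) : LinearMap.trace ℝ V f = ∑ k, B (f (e k)) (e k) := by
  rw [LinearMap.trace_eq_matrix_trace ℝ e, Matrix.trace]
  simp [LinearMap.toMatrix_apply, repr_eq_of_orthonormal he]

/-- The trace of a bilinear form with respect to an orthonormal basis does not change when the
basis is moved by an orthogonal complex structure. -/
theorem sum_map_map_of_orthonormal (he : ∀ i j, B (e i) (e j) = if i = j then 1 else 0)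
    {J : V →ₗ[ℝ] V} (hsq : ∀ x, J (J x) = -x) (hskew : ∀ x y, B (J x) y = -B x (J y))
    (f : V →ₗ[ℝ] V →ₗ[ℝ] ℝ) : ∑ i, f (J (e i)) (J (e i)) = ∑ i, f (e i) (e i) := by
  have key (x : V) : f (J x) (J x) = ∑ j, B (J x) (e j) * f (e j) (J x) := by
    exact (sum_bilin_mul_of_orthonormal he (f.flip (J x)) (J x)).symm
  calc ∑ i, f (J (e i)) (J (e i))
      = ∑ j, ∑ i, B (J (e i)) (e j) * f (e j) (J (e i)) := by
        simp_rw [key]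
        exact Finset.sum_comm
    _ = ∑ j, f (e j) (e j) := Finset.sum_congr rfl fun j _ => by
        have h1 := sum_bilin_mul_of_orthonormal he (f (e j) ∘ₗ J) (J (e j))
        have hs (x y : V) : B x (J y) = - B (J x) y := by rw [hskew, neg_neg]
        have hB (i : ι) : B (J (e i)) (e j) = - B (J (e j)) (e i) := by
          have h2 (a b : ι) : B (e a) (e b) = B (e b) (e a) := by
            rw [he, he]; simp only [eq_comm]
          have h3 (x : V) : B x (e j) = B (e j) x := by
            have : B.flip (e j) = B (e j) := e.ext fun i => h2 i j
            exact LinearMap.congr_fun this x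
          rw [h3, hs]
        simp_rw [hB, neg_mul, Finset.sum_neg_distrib]
        simp only [LinearMap.comp_apply, hsq, map_neg] at h1
        rw [h1, neg_neg]

theorem sum_map_right_of_orthonormal (he : ∀ i j, B (e i) (e j) = if i = j then 1 else 0)
    {J : V →ₗ[ℝ] V} (hsq : ∀ x, J (J x) = -x) (hskew : ∀ x y, B (J x) y = -B x (J y))
    (f : V →ₗ[ℝ] V →ₗ[ℝ] ℝ) : ∑ i, f (J (e i)) (e i) = -∑ i, f (e i) (J (e i)) := by
  have := sum_map_map_of_orthonormal he hsq hskew (f.compl₂ J)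
  simp only [LinearMap.compl₂_apply, hsq, map_neg, Finset.sum_neg_distrib] at this
  linarith

/-- If `D - D'J` commutes with `J` up to the identity that expresses integrability, and `D`, `D'`
lower a common filtration, then `D - D'J` is nilpotent as well: it lowers the filtration formed by
the `J`-invariant parts. -/
theorem trace_comp_eq_zero_of_filtration [FiniteDimensional ℝ V] {D D' J : V →ₗ[ℝ] V}
    (hJ : ∀ v, J (D v - D' (J v)) = D' v + D (J v))
    {F : ℕ → Submodule ℝ V} {N : ℕ} (h0 : F 0 = ⊤) (hN : F N = ⊥)
    (hD : ∀ k, ∀ v ∈ F k, D v ∈ F (k + 1)) (hD' : ∀ k, ∀ v ∈ F k, D' v ∈ F (k + 1)) :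
    LinearMap.trace ℝ V (D' ∘ₗ J) = 0 := by
  have nil (T : V →ₗ[ℝ] V) (P : ℕ → V → Prop) (hP0 : ∀ v, P 0 v) (hPN : ∀ v, P N v → v = 0)
      (hT : ∀ k v, P k v → P (k + 1) (T v)) : LinearMap.trace ℝ V T = 0 := by
    have hk (k : ℕ) (v : V) : P k ((T ^ k) v) := by
      induction k with
      | zero => exact hP0 _
      | succ k ih => rw [pow_succ', Module.End.mul_apply]; exact hT _ _ ih
    refine (LinearMap.isNilpotent_trace_of_isNilpotent ⟨N, ?_⟩).eq_zero
    ext v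
    exact hPN _ (hk N v)
  have h1 := nil D (fun k v => v ∈ F k) (by simp [h0]) (by simp [hN]) hD
  have h2 := nil (D - D' ∘ₗ J) (fun k v => v ∈ F k ∧ J v ∈ F k) (by simp [h0])
    (by simp +contextual [hN]) fun k v hv => by
      refine ⟨sub_mem (hD k v hv.1) (hD' k _ hv.2), ?_⟩
      rw [LinearMap.sub_apply, LinearMap.comp_apply, hJ]
      exact add_mem (hD' k v hv.1) (hD k _ hv.2)
  rw [map_sub, h1] at h2
  linarith

end LinearAlgebra

theorem sum_cyclic {ι : Type*} [Fintype ι] (f : ι → ι → ι → ℝ) :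
    ∑ i, ∑ j, ∑ k, f j k i = ∑ i, ∑ j, ∑ k, f i j k := by
  rw [Finset.sum_comm]
  exact Finset.sum_congr rfl fun _ _ => Finset.sum_comm

/-! ### Hermitian structures -/

section Hermitian

variable {g : Type*} [LieRing g] [LieAlgebra ℝ g] {J : g →ₗ[ℝ] g} {B : LinearMap.BilinForm ℝ g}

theorem IsHermitian.skew (h : IsHermitian J B) (x y : g) : B (J x) y = -B x (J y) := by
  have := h.compatible x (J y)
  rw [h.complex.sq_eq_neg] at this
  simpa [neg_eq_iff_eq_neg] using this

theorem IsHermitian.bismutTorsion_eq (h : IsHermitian J B) (x y z : g) :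
    bismutTorsion J B x y z = -(B ⁅J x, J y⁆ z + B ⁅J y, J z⁆ x + B ⁅J z, J x⁆ y) := by
  rw [← lie_skew (J z) (J x)]
  simp only [bismutTorsion, extDeriv₂, fundamentalForm, h.compatible, map_neg,
    LinearMap.neg_apply]
  ring

/-- Integrability, in the form that moves `J` inside the bracket. -/
theorem IsHermitian.map_lie (h : IsHermitian J B) (x y : g) :
    J (⁅x, y⁆ - ⁅J x, J y⁆) = ⁅J x, y⁆ + ⁅x, J y⁆ := by
  have h1 := h.complex.integrable x y
  have h2 : ⁅x, y⁆ - ⁅J x, J y⁆ = -J (⁅J x, y⁆ + ⁅x, J y⁆) := by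
    rw [← sub_eq_zero, ← h1]; abel
  rw [h2, map_neg, h.complex.sq_eq_neg, neg_neg]

theorem IsHermitian.bilin_lie (h : IsHermitian J B) (x y z : g) :
    B ⁅J x, y⁆ z + B ⁅x, J y⁆ z + B ⁅x, y⁆ (J z) - B ⁅J x, J y⁆ (J z) = 0 := by
  have h1 := congrArg (fun v => B v z) (h.map_lie x y)
  simp only [h.skew, map_add, map_sub, LinearMap.add_apply, LinearMap.sub_apply] at h1
  linarith

end Hermitian

/-! ### Structure constants and torsion as trilinear forms -/

section Forms

variable {g : Type*} [LieRing g] [LieAlgebra ℝ g] {J : g →ₗ[ℝ] g} {B : LinearMap.BilinForm ℝ g}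

/-- The covariant structure constants `(x, y, z) ↦ ⟨[x, y], z⟩`. -/
noncomputable def bracketForm (B : LinearMap.BilinForm ℝ g) : g →ₗ[ℝ] g →ₗ[ℝ] g →ₗ[ℝ] ℝ :=
  (LieModule.toEnd ℝ g g : g →ₗ[ℝ] g →ₗ[ℝ] g).compr₂ B

/-- Cyclic rotation `(x, y, z) ↦ T y z x` of the arguments of a trilinear form. -/
noncomputable def rotate (T : g →ₗ[ℝ] g →ₗ[ℝ] g →ₗ[ℝ] ℝ) : g →ₗ[ℝ] g →ₗ[ℝ] g →ₗ[ℝ] ℝ :=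
  (LinearMap.lflip.toLinearMap ∘ₗ T).flip

/-- The Bismut torsion of a Hermitian structure as a trilinear map. -/
noncomputable def torsionForm (J : g →ₗ[ℝ] g) (B : LinearMap.BilinForm ℝ g) :
    g →ₗ[ℝ] g →ₗ[ℝ] g →ₗ[ℝ] ℝ :=
  let T := (bracketForm (-B)).compl₁₂ J J
  T + rotate T + rotate (rotate T)

@[simp]
theorem bracketForm_apply (x y z : g) : bracketForm B x y z = B ⁅x, y⁆ z := rfl

theorem torsionForm_apply (x y z : g) : torsionForm J B x y z =
    -(B ⁅J x, J y⁆ z + B ⁅J y, J z⁆ x + B ⁅J z, J x⁆ y) := by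
  rw [neg_add, neg_add]
  rfl

theorem IsHermitian.torsionForm_apply_eq (h : IsHermitian J B) (x y z : g) :
    torsionForm J B x y z = bismutTorsion J B x y z := by
  rw [torsionForm_apply, h.bismutTorsion_eq]

theorem torsionForm_cyclic (x y z : g) : torsionForm J B x y z = torsionForm J B y z x := by
  simp only [torsionForm_apply]; ring

theorem torsionForm_swap (x y z : g) : torsionForm J B x y z = -torsionForm J B y x z := by
  simp only [torsionForm_apply]
  rw [← lie_skew (J y) (J x), ← lie_skew (J x) (J z), ← lie_skew (J z) (J y)]
  simp only [map_neg, LinearMap.neg_apply]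
  ring

/-- The connection whose torsion is the Bismut torsion (twice the metric pairing of `∇_z x` with
`y`, by Koszul's formula) preserves `J`. -/
theorem IsHermitian.bismut_connection (h : IsHermitian J B) (x y z : g) :
    -B ⁅J x, J y⁆ z + B ⁅J y, z⁆ (J x) + B ⁅z, J x⁆ (J y) + torsionForm J B (J x) (J y) z =
      -B ⁅x, y⁆ z + B ⁅y, z⁆ x + B ⁅z, x⁆ y + torsionForm J B x y z := by
  have h1 := h.bilin_lie y z (J x)
  have h2 := h.bilin_lie z x (J y)
  simp only [torsionForm_apply, h.complex.sq_eq_neg, map_neg, neg_lie, lie_neg,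
    LinearMap.neg_apply] at h1 h2 ⊢
  linear_combination h1 + h2

/-- The `3`-form `⟨[x, y], z⟩ + ⟨[y, z], x⟩ + ⟨[z, x], y⟩ + c(x, y, z)` has no `(3, 0)` and
`(0, 3)` parts. -/
theorem IsHermitian.cyclicForm_type (h : IsHermitian J B)
    {U : g → g → g → ℝ}
    (hU : ∀ x y z, U x y z =
      B ⁅x, y⁆ z + B ⁅y, z⁆ x + B ⁅z, x⁆ y + torsionForm J B x y z) (x y z : g) :
    U x y z = U (J x) (J y) z + U (J x) y (J z) + U x (J y) (J z) := by
  have h1 := h.bilin_lie x y (J z)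
  have h2 := h.bilin_lie y z (J x)
  have h3 := h.bilin_lie z x (J y)
  simp only [hU, torsionForm_apply, h.complex.sq_eq_neg, map_neg, neg_lie, lie_neg,
    LinearMap.neg_apply] at h1 h2 h3 ⊢
  linear_combination -2 * h1 - 2 * h2 - 2 * h3

end Forms

/-! ### The twisted Courant algebra -/

section Courant

variable {n : Type*} [LieRing n] [LieAlgebra ℝ n] {Jp Jm : n →ₗ[ℝ] n} {B : LinearMap.BilinForm ℝ n}

/-- The generalized complex structure on `n ⊕ n*` (in the coordinates of `courantAd`) that is `Jp`
on the vectors `(x, x)` and `Jm` on the vectors `(y, -y)`. -/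
noncomputable def generalizedComplex (Jp Jm : n →ₗ[ℝ] n) : n × n →ₗ[ℝ] n × n :=
  let x := (2⁻¹ : ℝ) • Jp ∘ₗ (LinearMap.fst ℝ n n + LinearMap.snd ℝ n n)
  let y := (2⁻¹ : ℝ) • Jm ∘ₗ (LinearMap.fst ℝ n n - LinearMap.snd ℝ n n)
  (x + y).prod (x - y)

theorem generalizedComplex_apply (v : n × n) :
    generalizedComplex Jp Jm v =
      ((2⁻¹ : ℝ) • Jp (v.1 + v.2) + (2⁻¹ : ℝ) • Jm (v.1 - v.2),
        (2⁻¹ : ℝ) • Jp (v.1 + v.2) - (2⁻¹ : ℝ) • Jm (v.1 - v.2)) := rfl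

theorem generalizedComplex_add_sub (x y : n) :
    generalizedComplex Jp Jm (x + y, x - y) = (Jp x + Jm y, Jp x - Jm y) := by
  rw [generalizedComplex_apply]
  simp only [map_add, map_sub]
  ext <;> module

theorem generalizedComplex_fst_add_snd (v : n × n) :
    (generalizedComplex Jp Jm v).1 + (generalizedComplex Jp Jm v).2 = Jp (v.1 + v.2) := by
  rw [generalizedComplex_apply]
  module

theorem generalizedComplex_fst_sub_snd (v : n × n) :
    (generalizedComplex Jp Jm v).1 - (generalizedComplex Jp Jm v).2 = Jm (v.1 - v.2) := by
  rw [generalizedComplex_apply]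
  module

variable [FiniteDimensional ℝ n]

/-- The adjoint action of `Z - ⟨Z, ·⟩` on the Courant algebra `n ⊕ n*` twisted by the `3`-form `H`,
with `n*` identified with `n` by the inner product: a pair `(X, Y)` stands for the vector `X` and
the covector `⟨Y, ·⟩`. -/
noncomputable def courantAd (hB : B.Nondegenerate) (H : n →ₗ[ℝ] n →ₗ[ℝ] n →ₗ[ℝ] ℝ) (Z : n) :
    n × n →ₗ[ℝ] n × n :=
  ((LieAlgebra.ad ℝ n Z : n →ₗ[ℝ] n) ∘ₗ LinearMap.fst ℝ n n).prod
    ((B.toDual hB).symm.toLinearMap ∘ₗ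
      ((H Z - (LieModule.toEnd ℝ n n : n →ₗ[ℝ] n →ₗ[ℝ] n).compr₂ (B Z)) ∘ₗ LinearMap.fst ℝ n n -
        B.compl₂ (LieAlgebra.ad ℝ n Z) ∘ₗ LinearMap.snd ℝ n n))

theorem courantAd_fst (hB : B.Nondegenerate) (H : n →ₗ[ℝ] n →ₗ[ℝ] n →ₗ[ℝ] ℝ) (Z : n) (v : n × n) :
    (courantAd hB H Z v).1 = ⁅Z, v.1⁆ := rfl

theorem bilin_courantAd_snd (hB : B.Nondegenerate) (H : n →ₗ[ℝ] n →ₗ[ℝ] n →ₗ[ℝ] ℝ) (Z : n)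
    (v : n × n) (w : n) :
    B (courantAd hB H Z v).2 w = H Z v.1 w - B Z ⁅v.1, w⁆ - B v.2 ⁅Z, w⁆ :=
  LinearMap.BilinForm.apply_toDual_symm_apply (hB := hB) _ _

/-- Vanishing of the Nijenhuis tensor of `generalizedComplex Jp Jm`, with one argument taken
among the vectors `(Z, -Z)`. -/
theorem generalizedComplex_courantAd (hp : IsHermitian Jp B) (hm : IsHermitian Jm B)
    (htor : ∀ x y z, torsionForm Jp B x y z = -torsionForm Jm B x y z)
    (hB : B.Nondegenerate) (Z : n) (v : n × n) :
    generalizedComplex Jp Jm (courantAd hB (torsionForm Jp B) Z v -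
        courantAd hB (torsionForm Jp B) (Jm Z) (generalizedComplex Jp Jm v)) =
      courantAd hB (torsionForm Jp B) (Jm Z) v +
        courantAd hB (torsionForm Jp B) Z (generalizedComplex Jp Jm v) := by
  obtain ⟨x, y, rfl⟩ : ∃ x y : n, v = (x + y, x - y) := by
    refine ⟨(2⁻¹ : ℝ) • (v.1 + v.2), (2⁻¹ : ℝ) • (v.1 - v.2), ?_⟩
    ext <;> module
  rw [generalizedComplex_add_sub]
  -- Two pairs agree when their `(x, x)`- and `(y, -y)`-components do.
  have hext (p q : n × n) (h1 : ∀ w, B (p.1 + p.2) w = B (q.1 + q.2) w)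
      (h2 : ∀ w, B (p.1 - p.2) w = B (q.1 - q.2) w) : p = q := by
    have hB' {a b : n} (hab : ∀ w, B a w = B b w) : a = b := by
      rw [← sub_eq_zero]
      by_contra hne
      have := hp.pos _ hne
      simp [hab] at this
    have h1' := hB' h1
    have h2' := hB' h2
    have h3 : p = ((2⁻¹ : ℝ) • ((p.1 + p.2) + (p.1 - p.2)),
        (2⁻¹ : ℝ) • ((p.1 + p.2) - (p.1 - p.2))) := by ext <;> module
    rw [h3, h1', h2']
    ext <;> module
  let V (a b c : n) : ℝ := -B ⁅a, b⁆ c + B ⁅b, c⁆ a + B ⁅c, a⁆ b + torsionForm Jp B a b c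
  let V' (a b c : n) : ℝ := -B ⁅a, b⁆ c + B ⁅b, c⁆ a + B ⁅c, a⁆ b + torsionForm Jm B a b c
  let U' (a b c : n) : ℝ := B ⁅a, b⁆ c + B ⁅b, c⁆ a + B ⁅c, a⁆ b + torsionForm Jm B a b c
  have hV (a b c : n) : V (Jp a) (Jp b) c = V a b c := hp.bismut_connection a b c
  have hV' (a b c : n) : V' (Jm a) (Jm b) c = V' a b c := hm.bismut_connection a b c
  have hU' := hm.cyclicForm_type (U := U') fun _ _ _ => rfl
  have neg2 (a b c : n) : V a (-b) c = -V a b c := by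
    simp only [V, map_neg, neg_lie, lie_neg, LinearMap.neg_apply]; ring
  have neg1' (a b c : n) : V' (-a) b c = -V' a b c := by
    simp only [V', map_neg, neg_lie, lie_neg, LinearMap.neg_apply]; ring
  have neg2' (a b c : n) : V' a (-b) c = -V' a b c := by
    simp only [V', map_neg, neg_lie, lie_neg, LinearMap.neg_apply]; ring
  have neg3' (a b c : n) : U' a b (-c) = -U' a b c := by
    simp only [U', map_neg, neg_lie, lie_neg, LinearMap.neg_apply]; ring
  have plus (Z x y w : n) :
      B ((courantAd hB (torsionForm Jp B) Z (x + y, x - y)).1 +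
        (courantAd hB (torsionForm Jp B) Z (x + y, x - y)).2) w = V x w Z - V' Z y w := by
    have c1 := torsionForm_cyclic (J := Jp) (B := B) Z x w
    simp only [V, V', courantAd_fst, bilin_courantAd_snd, map_add, map_sub, lie_add, add_lie,
      LinearMap.add_apply, LinearMap.sub_apply]
    rw [hp.symm Z, hp.symm Z, hp.symm x, hp.symm y, ← lie_skew Z w, ← c1, htor Z y w]
    simp only [map_neg, LinearMap.neg_apply]
    ring
  have minus (Z x y w : n) :
      B ((courantAd hB (torsionForm Jp B) Z (x + y, x - y)).1 -
        (courantAd hB (torsionForm Jp B) Z (x + y, x - y)).2) w = V' w Z x + U' Z y w := by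
    have c1 := torsionForm_cyclic (J := Jm) (B := B) w Z x
    simp only [U', V', courantAd_fst, bilin_courantAd_snd, map_add, map_sub, lie_add, add_lie,
      LinearMap.add_apply, LinearMap.sub_apply]
    rw [hp.symm Z, hp.symm Z, hp.symm x, hp.symm y, ← lie_skew Z w, htor Z x w, htor Z y w, c1]
    simp only [map_neg, LinearMap.neg_apply]
    ring
  refine hext _ _ (fun w => ?_) (fun w => ?_)
  · rw [generalizedComplex_fst_add_snd, hp.skew]
    simp only [Prod.fst_add, Prod.snd_add, Prod.fst_sub, Prod.snd_sub]
    rw [sub_add_sub_comm, LinearMap.map_sub₂, plus, plus, add_add_add_comm, LinearMap.map_add₂,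
      plus, plus]
    have h1 := hV x w (Jm Z)
    have h2 := hV x (Jp w) Z
    have h3 := hV' Z y (Jp w)
    have h4 := hV' Z (Jm y) w
    rw [hp.complex.sq_eq_neg, neg2] at h2
    rw [hm.complex.sq_eq_neg, neg2'] at h4
    linarith
  · rw [generalizedComplex_fst_sub_snd, hm.skew]
    simp only [Prod.fst_add, Prod.snd_add, Prod.fst_sub, Prod.snd_sub]
    rw [sub_sub_sub_comm, add_sub_add_comm, LinearMap.map_sub₂, minus, minus, LinearMap.map_add₂,
      minus, minus]
    have h1 := hV' w Z (Jp x)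
    have h2 := hV' (Jm w) Z x
    have h3 := hU' Z y (Jm w)
    rw [hm.complex.sq_eq_neg, neg1'] at h2
    rw [hm.complex.sq_eq_neg, neg3', neg3'] at h3
    linarith

end Courant

/-! ### Vanishing traces on nilpotent Lie algebras -/

section Nilpotent

variable {n : Type*} [LieRing n] [LieAlgebra ℝ n] [FiniteDimensional ℝ n] [LieRing.IsNilpotent n]
  {J Jp Jm : n →ₗ[ℝ] n} {B : LinearMap.BilinForm ℝ n}

/-- On a nilpotent Lie algebra, the `(1, 0)`-part of an element acts on the Lie algebra of
`(1, 0)`-vectors with trace zero. -/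
theorem IsHermitian.trace_ad_comp (h : IsHermitian J B) (u : n) :
    LinearMap.trace ℝ n ((LieAlgebra.ad ℝ n u : n →ₗ[ℝ] n) ∘ₗ J) = 0 := by
  obtain ⟨N, hN⟩ := (LieModule.isNilpotent_iff ℝ n n).mp ‹LieRing.IsNilpotent n›
  have hlow (w : n) (k : ℕ) (v : n)
      (hv : v ∈ (LieModule.lowerCentralSeries ℝ n n k).toSubmodule) :
      LieAlgebra.ad ℝ n w v ∈ (LieModule.lowerCentralSeries ℝ n n (k + 1)).toSubmodule := by
    rw [LieModule.lowerCentralSeries_succ]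
    exact LieSubmodule.lie_mem_lie (LieSubmodule.mem_top w) hv
  refine trace_comp_eq_zero_of_filtration (D := LieAlgebra.ad ℝ n (-J u))
    (F := fun k => (LieModule.lowerCentralSeries ℝ n n k).toSubmodule) (N := N)
    (fun v => ?_) (by simp) (by simp [hN]) (hlow _) (hlow _)
  have := h.map_lie (-J u) v
  simpa [h.complex.sq_eq_neg] using this

end Nilpotent

section Nilpotent

variable {n : Type*} [LieRing n] [LieAlgebra ℝ n] [LieRing.IsNilpotent n]
  {J Jp Jm : n →ₗ[ℝ] n} {B : LinearMap.BilinForm ℝ n}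
  {ι : Type*} [Fintype ι] [DecidableEq ι] {e : Basis ι ℝ n}

theorem sum_bilin_lie_self (he : ∀ i j, B (e i) (e j) = if i = j then 1 else 0) (u : n) :
    ∑ k, B ⁅u, e k⁆ (e k) = 0 := by
  have h1 := trace_eq_sum_of_orthonormal he (LieModule.toEnd ℝ n n u)
  rw [(LinearMap.isNilpotent_trace_of_isNilpotent
    (LieModule.isNilpotent_toEnd_of_isNilpotent ℝ n n u)).eq_zero] at h1
  exact h1.symm

/-- Up to normalization, both sides are the Lee form evaluated at `J z`. The two agree because the
remaining terms of the torsion are traces of `ad (J z)`, which is nilpotent. -/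
theorem IsHermitian.sum_torsionForm (h : IsHermitian J B)
    (he : ∀ i j, B (e i) (e j) = if i = j then 1 else 0) (z : n) :
    ∑ k, torsionForm J B z (J (e k)) (e k) = ∑ k, B ⁅e k, J (e k)⁆ z := by
  have h1 := sum_map_map_of_orthonormal he h.complex.sq_eq_neg h.skew (bracketForm B (J z))
  have h2 := sum_bilin_lie_self he (J z)
  simp only [bracketForm_apply, h2] at h1
  have h3 (k : ι) : torsionForm J B z (J (e k)) (e k) =
      B ⁅e k, J (e k)⁆ z + B ⁅J z, e k⁆ (e k) + B ⁅J z, J (e k)⁆ (J (e k)) := by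
    rw [torsionForm_apply, ← lie_skew (J (e k)) (J z)]
    simp only [h.complex.sq_eq_neg, map_neg, neg_lie, lie_neg, LinearMap.neg_apply]
    ring
  simp only [h3, Finset.sum_add_distrib, h1, h2, add_zero]

variable [FiniteDimensional ℝ n]

theorem IsHermitian.sum_bilin_lie_map (h : IsHermitian J B)
    (he : ∀ i j, B (e i) (e j) = if i = j then 1 else 0) (u : n) :
    ∑ k, B ⁅u, J (e k)⁆ (e k) = 0 := by
  rw [← h.trace_ad_comp u, trace_eq_sum_of_orthonormal he]
  rfl

theorem IsHermitian.sum_bilin_map_lie (h : IsHermitian J B)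
    (he : ∀ i j, B (e i) (e j) = if i = j then 1 else 0) (u : n) :
    ∑ k, B (J (e k)) ⁅u, e k⁆ = 0 := by
  have := sum_map_right_of_orthonormal he h.complex.sq_eq_neg h.skew
    ((bracketForm B u))
  simp only [bracketForm_apply, h.sum_bilin_lie_map he] at this
  simp_rw [h.symm (J _)]
  linarith

/-- Both Lee forms of a generalized Kähler structure on a nilpotent Lie algebra vanish: the
Courant algebra is nilpotent, so the `(1, 0)`-part of `Z - ⟨Z, ·⟩` acts on the `(1, 0)`-vectors of
`n ⊕ n*` with trace zero, and that trace is a multiple of the Lee form. -/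
theorem sum_bilin_lie_eq_zero (hp : IsHermitian Jp B) (hm : IsHermitian Jm B)
    (htor : ∀ x y z, torsionForm Jp B x y z = -torsionForm Jm B x y z)
    (he : ∀ i j, B (e i) (e j) = if i = j then 1 else 0) (z : n) :
    ∑ k, B ⁅e k, Jp (e k)⁆ z = 0 := by
  have hB : B.Nondegenerate := by
    constructor
    · intro x hx
      by_contra hne
      exact (hp.pos x hne).ne' (hx x)
    · intro x hx
      by_contra hne
      exact (hp.pos x hne).ne' (hx x)
  obtain ⟨N, hN⟩ := (LieModule.isNilpotent_iff ℝ n n).mp ‹LieRing.IsNilpotent n›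
  have hN' : (⊥ : LieSubmodule ℝ n n).ucs N = ⊤ :=
    top_le_iff.mp (LieSubmodule.lcs_le_iff (N₁ := ⊤) (N₂ := ⊥) N |>.mp hN.le)
  -- The filtration descends along the lower central series on the quotient `n`, then along the
  -- annihilators of the upper central series on `n*`.
  let F (k : ℕ) : Submodule ℝ (n × n) :=
    { carrier := {v | v.1 ∈ LieModule.lowerCentralSeries ℝ n n k ∧
        ∀ w ∈ (⊥ : LieSubmodule ℝ n n).ucs (k - N), B v.2 w = 0}
      add_mem' := fun {a b} ha hb => ⟨add_mem ha.1 hb.1, fun w hw => by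
        simp [ha.2 w hw, hb.2 w hw]⟩
      zero_mem' := ⟨zero_mem _, fun w _ => by simp⟩
      smul_mem' := fun c a ha => ⟨Submodule.smul_mem _ c ha.1, fun w hw => by
        simp [ha.2 w hw]⟩ }
  have hF (Z : n) (k : ℕ) (v : n × n) (hv : v ∈ F k) :
      courantAd hB (torsionForm Jp B) Z v ∈ F (k + 1) := by
    refine ⟨?_, fun w hw => ?_⟩
    · rw [courantAd_fst, LieModule.lowerCentralSeries_succ]
      exact LieSubmodule.lie_mem_lie (LieSubmodule.mem_top Z) hv.1
    · rw [bilin_courantAd_snd]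
      rcases lt_or_ge k N with hk | hk
      · rw [Nat.sub_eq_zero_of_le hk, LieSubmodule.ucs_zero, LieSubmodule.mem_bot] at hw
        simp [hw]
      · have h0 : v.1 = 0 := by
          have := LieModule.antitone_lowerCentralSeries ℝ n n hk hv.1
          rwa [hN, LieSubmodule.mem_bot] at this
        rw [Nat.sub_add_comm hk, LieSubmodule.ucs_succ, LieSubmodule.mem_normalizer] at hw
        simp [h0, hv.2 _ (hw Z)]
  have htr := trace_comp_eq_zero_of_filtration
    (generalizedComplex_courantAd hp hm htor hB (-Jm z)) (F := F) (N := N + N)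
    (by
      rw [eq_top_iff]
      intro v _
      refine ⟨by simp, fun w hw => ?_⟩
      rw [Nat.zero_sub, LieSubmodule.ucs_zero, LieSubmodule.mem_bot] at hw
      simp [hw])
    (by
      rw [eq_bot_iff]
      intro v hv
      have h1 := LieModule.antitone_lowerCentralSeries ℝ n n (Nat.le_add_left N N) hv.1
      rw [hN, LieSubmodule.mem_bot] at h1
      have h2 := hv.2 v.2 (by rw [Nat.add_sub_cancel, hN']; exact LieSubmodule.mem_top _)
      have h3 : v.2 = 0 := by
        by_contra hne
        exact (hp.pos _ hne).ne' h2
      exact Prod.ext h1 h3)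
    (hF _) (hF _)
  -- The block on vectors contributes traces of `ad z ∘ J₊` and `ad z ∘ J₋`, which vanish; the block
  -- on covectors contributes the Lee forms.
  rw [map_neg, hm.complex.sq_eq_neg, neg_neg,
    LinearMap.trace_eq_matrix_trace ℝ (e.prod e), Matrix.trace, Fintype.sum_sum_type] at htr
  simp only [Matrix.diag_apply, LinearMap.toMatrix_apply, Basis.prod_repr_inl,
    Basis.prod_repr_inr, repr_eq_of_orthonormal he,
    LinearMap.comp_apply, courantAd_fst, bilin_courantAd_snd, generalizedComplex_apply,
    Basis.prod_apply, Sum.elim_inl, Sum.elim_inr, Function.comp_apply, LinearMap.inl_apply,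
    LinearMap.inr_apply, add_zero, sub_zero, zero_add, zero_sub, map_neg, map_add, map_smul,
    lie_add, lie_smul, smul_lie, LinearMap.add_apply,
    LinearMap.smul_apply, Finsupp.add_apply, Finsupp.smul_apply,
    smul_neg, sub_neg_eq_add, ← sub_eq_add_neg, map_sub, sub_lie, LinearMap.sub_apply,
    Finset.sum_add_distrib, Finset.sum_sub_distrib, smul_eq_mul, ← Finset.mul_sum,
    hp.sum_bilin_lie_map he, hm.sum_bilin_lie_map he, hp.sum_bilin_map_lie he,
    hm.sum_bilin_map_lie he, hp.sum_torsionForm he] at htr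
  have h1 : ∑ k, torsionForm Jp B z (Jm (e k)) (e k) = -∑ k, B ⁅e k, Jm (e k)⁆ z := by
    simp only [htor, Finset.sum_neg_distrib, hm.sum_torsionForm he]
  have h2 (J : n →ₗ[ℝ] n) : ∑ k, B z ⁅J (e k), e k⁆ = -∑ k, B ⁅e k, J (e k)⁆ z := by
    rw [← Finset.sum_neg_distrib]
    refine Finset.sum_congr rfl fun k _ => ?_
    rw [hp.symm, ← lie_skew, map_neg, LinearMap.neg_apply]
  rw [h1, h2, h2] at htr
  linarith

end Nilpotent

/-! ### Nilpotent generalized Kähler Lie algebras are abelian -/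

section Nilpotent

variable {n : Type*} [LieRing n] [LieAlgebra ℝ n] {Jp Jm : n →ₗ[ℝ] n} {B : LinearMap.BilinForm ℝ n}

/-- The first Bianchi identity for the bracket of the vectors `x + ⟨x, ·⟩` in the Courant algebra
twisted by a closed `3`-form `H`: the cyclic sum of `⟨[x, y], [z, w]⟩` vanishes. -/
theorem courant_bianchi {H : n →ₗ[ℝ] n →ₗ[ℝ] n →ₗ[ℝ] ℝ}
    (hcyc : ∀ x y z, H x y z = H y z x) (hswap : ∀ x y z, H x y z = -H y x z)
    (hclosed : ∀ w x y z, extDeriv₃ (fun a b c => H a b c) w x y z = 0)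
    {Ψ : n →ₗ[ℝ] n →ₗ[ℝ] n →ₗ[ℝ] ℝ}
    (hΨ : ∀ x y z, Ψ x y z = B ⁅y, z⁆ x + B ⁅z, x⁆ y + H x y z) (x y z w : n) :
    Ψ x y ⁅z, w⁆ + Ψ z w ⁅x, y⁆ + (Ψ y z ⁅x, w⁆ + Ψ x w ⁅y, z⁆) +
      (Ψ z x ⁅y, w⁆ + Ψ y w ⁅z, x⁆) = 0 := by
  have hd := hclosed x y z w
  have j (a b c v : n) : B ⁅⁅a, b⁆, c⁆ v + B ⁅⁅b, c⁆, a⁆ v + B ⁅⁅c, a⁆, b⁆ v = 0 := by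
    have := congrArg (fun u => B u v) (lie_jacobi a b c)
    simp only [map_add, LinearMap.add_apply, map_zero, LinearMap.zero_apply] at this
    rw [← lie_skew ⁅a, b⁆ c, ← lie_skew ⁅b, c⁆ a, ← lie_skew ⁅c, a⁆ b]
    simp only [map_neg, LinearMap.neg_apply]
    linarith
  have s (a b c : n) : B ⁅a, b⁆ c = -B ⁅b, a⁆ c := by
    rw [← lie_skew, map_neg, LinearMap.neg_apply]
  have s2 (a b c v : n) : B ⁅⁅a, b⁆, c⁆ v = -B ⁅⁅b, a⁆, c⁆ v := by
    rw [← lie_skew a b, neg_lie, map_neg, LinearMap.neg_apply]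
  have j1 := j x y z w
  have j2 := j y z w x
  have j3 := j z x w y
  have j4 := j x y w z
  have e1 : H ⁅x, y⁆ z w = H z w ⁅x, y⁆ := hcyc _ _ _
  have e2 : H ⁅x, z⁆ y w = -H y w ⁅z, x⁆ := by rw [hcyc, ← lie_skew, map_neg]
  have e3 : H ⁅x, w⁆ y z = H y z ⁅x, w⁆ := hcyc _ _ _
  have e4 : H ⁅y, z⁆ x w = H x w ⁅y, z⁆ := hcyc _ _ _
  have e5 : H ⁅y, w⁆ x z = -H z x ⁅y, w⁆ := by rw [hcyc, hswap]
  have e6 : H ⁅z, w⁆ x y = H x y ⁅z, w⁆ := hcyc _ _ _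
  simp only [extDeriv₃, e1, e2, e3, e4, e5, e6] at hd
  simp only [hΨ]
  rw [s y ⁅z, w⁆, s w ⁅x, y⁆, s z ⁅x, w⁆, s w ⁅y, z⁆, s x ⁅y, w⁆, s w ⁅z, x⁆]
  linear_combination j1 - j2 - j3 - j4 - hd + s2 y w z x + s2 z w x y + s2 x w y z

variable [LieRing.IsNilpotent n] {ι : Type*} [Fintype ι] [DecidableEq ι]
  {e : Basis ι ℝ n}

/-- The Killing form of a nilpotent Lie algebra vanishes; in an orthonormal basis, its trace is
a quadratic expression in the structure constants. -/
theorem sum_structure_constants_eq_zero (he : ∀ i j, B (e i) (e j) = if i = j then 1 else 0) :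
    ∑ i, ∑ j, ∑ k, B ⁅e i, e j⁆ (e k) * B ⁅e j, e k⁆ (e i) = 0 := by
  have h1 (j : ι) : ∑ i, ∑ k, B ⁅e j, e i⁆ (e k) * B ⁅e j, e k⁆ (e i) = 0 := by
    have h2 := LinearMap.congr_fun₂ (LieModule.traceForm_eq_zero_of_isNilpotent ℝ n n) (e j) (e j)
    rw [LieModule.traceForm_apply_apply, trace_eq_sum_of_orthonormal he] at h2
    rw [LinearMap.zero_apply, LinearMap.zero_apply] at h2
    rw [← h2]
    refine Finset.sum_congr rfl fun i _ => ?_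
    exact sum_bilin_mul_of_orthonormal he ((bracketForm B (e j)).flip (e i)) ⁅e j, e i⁆
  rw [Finset.sum_comm]
  refine Finset.sum_eq_zero fun j _ => ?_
  rw [← neg_eq_zero, ← h1 j, ← Finset.sum_neg_distrib]
  refine Finset.sum_congr rfl fun i _ => ?_
  rw [← Finset.sum_neg_distrib]
  refine Finset.sum_congr rfl fun k _ => ?_
  rw [← lie_skew (e i), map_neg, LinearMap.neg_apply]
  ring

variable [FiniteDimensional ℝ n]

/-- A nilpotent Lie algebra with a generalized Kähler structure is abelian. -/
theorem IsGeneralizedKahler.lie_eq_zero (h : IsGeneralizedKahler Jp Jm B) (x y : n) :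
    ⁅x, y⁆ = 0 := by
  have hp := h.hermitian_plus
  have hm := h.hermitian_minus
  have htor (x y z : n) : torsionForm Jp B x y z = -torsionForm Jm B x y z := by
    rw [hp.torsionForm_apply_eq, hm.torsionForm_apply_eq, h.torsion_eq_neg]
  obtain ⟨e, he⟩ := exists_orthonormal_basis hp.symm hp.pos
  let H := torsionForm Jp B
  have hclosed (w x y z : n) : extDeriv₃ (fun a b c => H a b c) w x y z = 0 := by
    simp only [H, hp.torsionForm_apply_eq]
    exact h.torsion_closed w x y z
  let T := bracketForm B
  let Ψ := rotate T + rotate (rotate T) + H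
  have hΨ (x y z : n) : Ψ x y z = B ⁅y, z⁆ x + B ⁅z, x⁆ y + H x y z := rfl
  let U (x y z : n) : ℝ := B ⁅x, y⁆ z + B ⁅y, z⁆ x + B ⁅z, x⁆ y + H x y z
  let V (x y z : n) : ℝ := -B ⁅x, y⁆ z + B ⁅y, z⁆ x + B ⁅z, x⁆ y + H x y z
  have hV (x y z : n) : V (Jp x) (Jp y) z = V x y z := hp.bismut_connection x y z
  have hU (x y z : n) := hp.cyclicForm_type (U := U) (fun _ _ _ => rfl) x y z
  have hUcyc (x y z : n) : U x y z = U y z x := by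
    have := torsionForm_cyclic (J := Jp) (B := B) x y z
    simp only [U, H, this]
    ring
  have bianchi := courant_bianchi (torsionForm_cyclic (J := Jp) (B := B))
    torsionForm_swap hclosed hΨ
  have hlee (z : n) : ∑ k, T (e k) (Jp (e k)) z = 0 := sum_bilin_lie_eq_zero hp hm htor he z
  have hlee' : ∑ k, ⁅e k, Jp (e k)⁆ = 0 := by
    by_contra hne
    refine (hp.pos _ hne).ne' ?_
    rw [LinearMap.map_sum₂]
    exact hlee _
  -- The first Bianchi identity, contracted twice with `J`.
  have contracted : ∑ i, ∑ j, (Ψ (e i) (e j) ⁅Jp (e i), Jp (e j)⁆ +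
      Ψ (Jp (e i)) (Jp (e j)) ⁅e i, e j⁆) = 0 := by
    have h1 : ∑ i, ∑ j, (Ψ (e i) (Jp (e i)) ⁅e j, Jp (e j)⁆ +
        Ψ (e j) (Jp (e j)) ⁅e i, Jp (e i)⁆) = 0 := by
      simp only [Finset.sum_add_distrib, ← map_sum, hlee', map_zero, Finset.sum_const_zero]
      rw [Finset.sum_comm]
      simp only [← map_sum, hlee', map_zero, Finset.sum_const_zero, zero_add]
    have h2 (j) : ∑ i, (Ψ (Jp (e i)) (e j) ⁅e i, Jp (e j)⁆ + Ψ (e i) (Jp (e j)) ⁅Jp (e i), e j⁆) =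
        -∑ i, (Ψ (e i) (e j) ⁅Jp (e i), Jp (e j)⁆ + Ψ (Jp (e i)) (Jp (e j)) ⁅e i, e j⁆) := by
      exact sum_map_right_of_orthonormal he hp.complex.sq_eq_neg hp.skew
        (LinearMap.mk₂ ℝ (fun a b => Ψ a (e j) ⁅b, Jp (e j)⁆ + Ψ b (Jp (e j)) ⁅a, e j⁆)
          (by intros; simp; ring) (by intros; simp; ring) (by intros; simp; ring)
          (by intros; simp; ring))
    have h3 (i j) := bianchi (e i) (Jp (e i)) (e j) (Jp (e j))
    have hskew (a b c : n) : Ψ a b c = -Ψ b a c := by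
      have := torsionForm_swap (J := Jp) (B := B) a b c
      simp only [hΨ, H, this]
      rw [← lie_skew c a, ← lie_skew b c]
      simp only [map_neg, LinearMap.neg_apply]
      ring
    have h4 (j) : ∑ i, (Ψ (e i) (Jp (e i)) ⁅e j, Jp (e j)⁆ +
        Ψ (e j) (Jp (e j)) ⁅e i, Jp (e i)⁆) =
        2 * ∑ i, (Ψ (e i) (e j) ⁅Jp (e i), Jp (e j)⁆ + Ψ (Jp (e i)) (Jp (e j)) ⁅e i, e j⁆) := by
      rw [two_mul, ← sub_eq_iff_eq_add, sub_eq_add_neg, ← h2 j, ← Finset.sum_add_distrib]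
      refine Finset.sum_congr rfl fun i _ => ?_
      have := h3 i j
      rw [hskew (e j) (e i), ← lie_skew (e j) (e i), map_neg] at this
      linarith
    rw [Finset.sum_comm, Finset.sum_congr rfl fun j _ => h4 j, ← Finset.mul_sum,
      Finset.sum_comm] at h1
    linarith
  -- In terms of `U` and `V`, the contracted identity compares the two mean squares.
  have hUV : ∑ i, ∑ j, ∑ k, U (e i) (e j) (e k) * U (Jp (e i)) (Jp (e j)) (e k) =
      ∑ i, ∑ j, ∑ k, V (e i) (e j) (e k) ^ 2 := by
    rw [← sub_eq_zero, ← Finset.sum_sub_distrib, ← mul_zero 2, ← contracted, Finset.mul_sum]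
    refine Finset.sum_congr rfl fun i _ => ?_
    rw [← Finset.sum_sub_distrib, Finset.mul_sum]
    refine Finset.sum_congr rfl fun j _ => ?_
    rw [← sum_bilin_mul_of_orthonormal he (Ψ (e i) (e j)),
      ← sum_bilin_mul_of_orthonormal he (Ψ (Jp (e i)) (Jp (e j))), ← Finset.sum_add_distrib,
      Finset.mul_sum, ← Finset.sum_sub_distrib]
    refine Finset.sum_congr rfl fun k _ => ?_
    have h1 (x y z : n) : U x y z = B ⁅x, y⁆ z + Ψ x y z := by simp only [U, hΨ]; ring
    have h2 (x y z : n) : V x y z = -B ⁅x, y⁆ z + Ψ x y z := by simp only [V, hΨ]; ring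
    have h3 := hV (e i) (e j) (e k)
    rw [sq]
    nth_rewrite 1 [← h3]
    rw [h1, h1, h2, h2]
    ring
  -- `U` has no `(3, 0)`-part, so each of the three pairs of arguments accounts for a third.
  have hUU : ∑ i, ∑ j, ∑ k, U (e i) (e j) (e k) ^ 2 =
      3 * ∑ i, ∑ j, ∑ k, U (e i) (e j) (e k) * U (Jp (e i)) (Jp (e j)) (e k) := by
    let f (i j k) := U (e i) (e j) (e k) * U (Jp (e i)) (Jp (e j)) (e k)
    have h1 (i j k) : U (e i) (e j) (e k) ^ 2 = f i j k + f k i j + f j k i := by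
      rw [sq]
      nth_rewrite 2 [hU]
      simp only [f]
      rw [hUcyc (e k) (e i) (e j), hUcyc (Jp (e k)) (Jp (e i)) (e j), ← hUcyc (e i) (e j) (e k),
        ← hUcyc (e i) (Jp (e j)) (Jp (e k)), ← hUcyc (Jp (e k)) (Jp (e i)) (e j), hUcyc (Jp (e k))]
      ring
    have h2 := sum_cyclic f
    have h3 := sum_cyclic fun i j k => f j k i
    simp only [h1, Finset.sum_add_distrib]
    linarith
  have hkill := sum_structure_constants_eq_zero he
  let c (i j k) := B ⁅e i, e j⁆ (e k)
  let t (i j k) := H (e i) (e j) (e k)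
  have ht (i j k) : t i j k = t j k i := torsionForm_cyclic _ _ _
  -- Expanding `∑ U² = 3 ∑ V²`: mixed terms in `c` and `t` cancel by the cyclic symmetry of `t`, and
  -- mixed terms in `c` alone add up to the trace of the Killing form.
  have hsum : ∑ i, ∑ j, ∑ k, (6 * c i j k ^ 2 + 2 * t i j k ^ 2) = 0 := by
    let p (i j k) := c i j k ^ 2
    let q (i j k) := c i j k * c j k i
    let r (i j k) := t i j k * c i j k
    have h1 (i j k) : U (e i) (e j) (e k) ^ 2 - 3 * V (e i) (e j) (e k) ^ 2 =
        -2 * (p i j k + p j k i + p k i j + t i j k ^ 2) + 8 * q i j k + 8 * q k i j - 4 * q j k i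
          + 8 * r i j k - 4 * r j k i - 4 * r k i j := by
      simp only [p, q, r, ht k i j, ← ht i j k]
      simp only [U, V, c, t]
      ring
    have h2 : ∑ i, ∑ j, ∑ k, (U (e i) (e j) (e k) ^ 2 - 3 * V (e i) (e j) (e k) ^ 2) = 0 := by
      simp only [Finset.sum_sub_distrib, ← Finset.mul_sum]
      rw [hUU, hUV, sub_self]
    have q0 : ∑ i, ∑ j, ∑ k, q i j k = 0 := hkill
    have p1 := sum_cyclic p
    have p2 := sum_cyclic fun i j k => p j k i
    have q1 := sum_cyclic q
    have q2 := sum_cyclic fun i j k => q j k i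
    have r1 := sum_cyclic r
    have r2 := sum_cyclic fun i j k => r j k i
    simp only [h1, Finset.sum_add_distrib, Finset.sum_sub_distrib, ← Finset.mul_sum] at h2
    simp only [Finset.sum_add_distrib, ← Finset.mul_sum]
    simp only [p] at *
    linarith
  have hc (i j k) : c i j k = 0 := by
    have nn (i j k) : 0 ≤ 6 * c i j k ^ 2 + 2 * t i j k ^ 2 := by positivity
    rw [Finset.sum_eq_zero_iff_of_nonneg fun i _ => Finset.sum_nonneg fun j _ =>
      Finset.sum_nonneg fun k _ => nn i j k] at hsum
    have h1 := hsum i (Finset.mem_univ i)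
    rw [Finset.sum_eq_zero_iff_of_nonneg fun j _ => Finset.sum_nonneg fun k _ => nn i j k] at h1
    have h2 := h1 j (Finset.mem_univ j)
    rw [Finset.sum_eq_zero_iff_of_nonneg fun k _ => nn i j k] at h2
    have h3 := h2 k (Finset.mem_univ k)
    nlinarith [sq_nonneg (c i j k), sq_nonneg (t i j k)]
  have hT : T = 0 := e.ext fun i => e.ext fun j => e.ext fun k => hc i j k
  by_contra hne
  refine (hp.pos _ hne).ne' ?_
  exact LinearMap.congr_fun (LinearMap.congr_fun₂ hT x y) ⁅x, y⁆

end Nilpotent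

/-! ### Commutators and skew parts -/

section LinearAlgebra

variable {V : Type*} [AddCommGroup V] [Module ℝ V]

/-- The powers of `C` are eigenvectors of the bracket with `D`, for the eigenvalues `0, 1, 2, …`;
only finitely many of them can be nonzero. -/
theorem isNilpotent_of_lie_eq_self [FiniteDimensional ℝ V] {C D : Module.End ℝ V}
    (h : C * D - D * C = C) : IsNilpotent C := by
  by_contra hC
  have hC' (k : ℕ) : C ^ k ≠ 0 := fun hk => hC ⟨k, hk⟩
  let φ : Module.End ℝ (Module.End ℝ V) := LinearMap.mulRight ℝ D - LinearMap.mulLeft ℝ D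
  have hφ (k : ℕ) : φ (C ^ k) = (k : ℝ) • C ^ k := by
    simp only [φ, LinearMap.sub_apply, LinearMap.mulRight_apply, LinearMap.mulLeft_apply]
    induction k with
    | zero => simp
    | succ k ih =>
      have : C ^ (k + 1) * D - D * C ^ (k + 1) =
          C ^ k * (C * D - D * C) + (C ^ k * D - D * C ^ k) * C := by
        rw [pow_succ]; noncomm_ring
      rw [this, h, ih, smul_mul_assoc, ← pow_succ]
      push_cast
      module
  have hev (k : ℕ) : φ.HasEigenvalue (k : ℝ) :=
    Module.End.hasEigenvalue_of_hasEigenvector ⟨Module.End.mem_eigenspace_iff.mpr (hφ k), hC' k⟩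
  exact (Set.infinite_range_of_injective (Nat.cast_injective (R := ℝ)))
    ((Module.End.finite_hasEigenvalue φ).subset (by rintro _ ⟨k, rfl⟩; exact hev k))

/-- The squared norm of the skew part `q` of `a ∘ j`, as a trace; contracting `dc = 0` with `j`
produces this trace. -/
theorem sum_sq_skewPart {ι : Type*} [Fintype ι] [DecidableEq ι] {B : LinearMap.BilinForm ℝ V} {e : Basis ι ℝ V}
    (he : ∀ i j, B (e i) (e j) = if i = j then 1 else 0) {j : V →ₗ[ℝ] V}
    (hsq : ∀ x, j (j x) = -x) (hskew : ∀ x y, B (j x) y = -B x (j y)) (a : V →ₗ[ℝ] V)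
    {q : V → V → ℝ} (hq : ∀ x y, q x y = B (a (j x)) y - B (a (j y)) x) :
    ∑ k, ∑ l, q (e k) (e l) ^ 2 = ∑ k, (q (a (e k)) (j (e k)) - q (a (j (e k))) (e k)) := by
  let m : V →ₗ[ℝ] V := a ∘ₗ j
  have hm (x : V) : a (j x) = m x := rfl
  have h1 (k : ι) : ∑ l, B (m (e k)) (e l) * B (m (e l)) (e k) = B (m (m (e k))) (e k) :=
    sum_bilin_mul_of_orthonormal he ((B ∘ₗ m).flip (e k)) (m (e k))
  have h2 (k : ι) : ∑ l, B (m (e k)) (e l) ^ 2 = B (m (e k)) (m (e k)) := by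
    simp only [sq]
    exact sum_bilin_mul_of_orthonormal he (B (m (e k))) (m (e k))
  have h3 : ∑ k, B (m (m (e k))) (e k) = -∑ k, B (m (a (e k))) (j (e k)) :=
    sum_map_right_of_orthonormal he hsq hskew (B ∘ₗ m ∘ₗ a)
  have h4 : ∑ k, B (m (e k)) (m (e k)) = ∑ k, B (a (e k)) (a (e k)) :=
    sum_map_map_of_orthonormal he hsq hskew (B.compl₁₂ a a)
  have h5 (k : ι) : ∑ l, q (e k) (e l) ^ 2 =
      B (m (e k)) (m (e k)) - 2 * B (m (m (e k))) (e k) + ∑ l, B (m (e l)) (e k) ^ 2 := by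
    rw [← h1, ← h2, Finset.mul_sum, ← Finset.sum_sub_distrib, ← Finset.sum_add_distrib]
    refine Finset.sum_congr rfl fun l _ => ?_
    rw [hq, hm, hm]
    ring
  have h6 (k : ι) : q (a (e k)) (j (e k)) - q (a (j (e k))) (e k) =
      B (m (a (e k))) (j (e k)) + B (a (e k)) (a (e k)) - B (m (m (e k))) (e k) +
        B (m (e k)) (m (e k)) := by
    simp only [hq, hsq, hm, map_neg, LinearMap.neg_apply]
    ring
  simp only [h5, h6, Finset.sum_add_distrib, Finset.sum_sub_distrib, ← Finset.mul_sum]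
  rw [Finset.sum_comm]
  simp only [h2]
  linarith

end LinearAlgebra

/-! ### Abelian nilradicals of codimension two -/

section Codimension

variable {g : Type*} [LieRing g] [LieAlgebra ℝ g] {h : LieIdeal ℝ g}

theorem Preserves.map_mem {J : g →ₗ[ℝ] g} (hJ : Preserves J h) {x : g} (hx : x ∈ h) : J x ∈ h := by
  have : J x ∈ h.toSubmodule := by
    rw [← hJ]
    exact Submodule.mem_map_of_mem hx
  exact this

theorem IsHermitian.restrict {J : g →ₗ[ℝ] g} {B : LinearMap.BilinForm ℝ g} (hJ : IsHermitian J B)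
    (hmap : ∀ x ∈ h.toSubmodule, J x ∈ h.toSubmodule) :
    IsHermitian (g := h) (J.restrict hmap) (B.restrict h.toSubmodule) where
  complex :=
    { sq_eq_neg := fun x => Subtype.ext (hJ.complex.sq_eq_neg x)
      integrable := fun x y => Subtype.ext (hJ.complex.integrable x y) }
  symm x y := hJ.symm x y
  pos x hx := hJ.pos x fun h0 => hx (Subtype.ext h0)
  compatible x y := hJ.compatible x y

theorem IsGeneralizedKahler.restrict {Jp Jm : g →ₗ[ℝ] g} {B : LinearMap.BilinForm ℝ g}
    (hJ : IsGeneralizedKahler Jp Jm B) (hp : ∀ x ∈ h.toSubmodule, Jp x ∈ h.toSubmodule)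
    (hm : ∀ x ∈ h.toSubmodule, Jm x ∈ h.toSubmodule) :
    IsGeneralizedKahler (g := h) (Jp.restrict hp) (Jm.restrict hm) (B.restrict h.toSubmodule) where
  hermitian_plus := hJ.hermitian_plus.restrict hp
  hermitian_minus := hJ.hermitian_minus.restrict hm
  torsion_eq_neg x y z := hJ.torsion_eq_neg x y z
  torsion_closed w x y z := hJ.torsion_closed w x y z

variable [FiniteDimensional ℝ g]

/-- An abelian nilradical of codimension two contains the derived algebra. -/
theorem IsNilradical.lie_mem_of_codim_two (hh : IsNilradical h)
    (habel : ∀ x ∈ h, ∀ y ∈ h, ⁅x, y⁆ = 0) {e₁ e₂ : g}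
    (hspan : ∀ x, ∃ y ∈ h, ∃ a b : ℝ, x = y + a • e₁ + b • e₂) : ⁅e₁, e₂⁆ ∈ h := by
  by_contra hW
  set W := ⁅e₁, e₂⁆ with hWdef
  obtain ⟨u, hu, α, β, huW⟩ := hspan W
  have hW1 : ⁅e₁, W⁆ = ⁅e₁, u⁆ + β • W := by
    conv_lhs => rw [huW]
    simp [← hWdef]
  have hW2 : ⁅e₂, W⁆ = ⁅e₂, u⁆ - α • W := by
    conv_lhs => rw [huW]
    rw [lie_add, lie_add, lie_smul, lie_smul, lie_self, ← lie_skew e₂ e₁, ← hWdef]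
    module
  have hlie (z : g) : ∃ y ∈ h, ∃ c : ℝ, ⁅z, W⁆ = y + c • W := by
    obtain ⟨y, hy, a, b, rfl⟩ := hspan z
    refine ⟨⁅y, W⁆ + a • ⁅e₁, u⁆ + b • ⁅e₂, u⁆, ?_, a * β - b * α, ?_⟩
    · exact add_mem (add_mem (lie_mem_left ℝ g h y W hy)
        (Submodule.smul_mem _ a (lie_mem_right ℝ g h e₁ u hu)))
        (Submodule.smul_mem _ b (lie_mem_right ℝ g h e₂ u hu))
    · rw [add_lie, add_lie, smul_lie, smul_lie, hW1, hW2]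
      module
  let k : LieIdeal ℝ g :=
    { carrier := {x | ∃ y ∈ h, ∃ c : ℝ, x = y + c • W}
      add_mem' := by
        rintro _ _ ⟨y, hy, c, rfl⟩ ⟨y', hy', c', rfl⟩
        exact ⟨y + y', add_mem hy hy', c + c', by module⟩
      zero_mem' := ⟨0, zero_mem _, 0, by simp⟩
      smul_mem' := by
        rintro r _ ⟨y, hy, c, rfl⟩
        exact ⟨r • y, Submodule.smul_mem _ r hy, r * c, by module⟩
      lie_mem := by
        rintro z _ ⟨y, hy, c, rfl⟩
        obtain ⟨v, hv, d, hd⟩ := hlie z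
        refine ⟨⁅z, y⁆ + c • v, add_mem (lie_mem_right ℝ g h z y hy)
          (Submodule.smul_mem _ c hv), c * d, ?_⟩
        rw [lie_add, lie_smul, hd]
        module }
  let ρ := LieModule.toEnd ℝ g h
  have hρh (y : g) (hy : y ∈ h) : ρ y = 0 := by
    ext v
    exact congrArg Subtype.val (Subtype.ext (habel y hy v v.2) : ⁅y, v⁆ = (0 : h))
  have hρlie (x y : g) : ρ x * ρ y - ρ y * ρ x = ρ ⁅x, y⁆ := by
    ext v
    exact congrArg Subtype.val (lie_lie x y v).symm
  have hnil : IsNilpotent (ρ W) := by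
    have h1 : ρ W * ρ e₁ - ρ e₁ * ρ W = -β • ρ W := by
      rw [hρlie, ← lie_skew, hW1, map_neg, map_add, map_smul,
        hρh _ (lie_mem_right ℝ g h e₁ u hu)]
      module
    have h2 : ρ W * ρ e₂ - ρ e₂ * ρ W = α • ρ W := by
      rw [hρlie, ← lie_skew, hW2, map_neg, map_sub, map_smul,
        hρh _ (lie_mem_right ℝ g h e₂ u hu)]
      module
    by_cases hα : α = 0
    · have hβ : β ≠ 0 := by
        rintro rfl
        exact hW (by rw [huW, hα]; simpa using hu)
      refine isNilpotent_of_lie_eq_self (D := (-β)⁻¹ • ρ e₁) ?_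
      rw [mul_smul_comm, smul_mul_assoc, ← smul_sub, h1, smul_smul, inv_mul_cancel₀ (neg_ne_zero.mpr hβ), one_smul]
    · refine isNilpotent_of_lie_eq_self (D := α⁻¹ • ρ e₂) ?_
      rw [mul_smul_comm, smul_mul_assoc, ← smul_sub, h2, smul_smul, inv_mul_cancel₀ hα, one_smul]
  obtain ⟨m, hm⟩ := hnil
  have hk : LieRing.IsNilpotent k := by
    rw [LieAlgebra.isNilpotent_iff_forall (R := ℝ)]
    rintro ⟨x, y, hy, c, hx⟩
    refine ⟨m + 1, ?_⟩
    have hρx : ρ x = c • ρ W := by rw [hx, map_add, map_smul, hρh y hy, zero_add]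
    ext ⟨v, y', hy', c', hv⟩
    have hfirst : ⁅x, v⁆ ∈ h := by
      rw [hx, hv]
      simp only [add_lie, lie_add, smul_lie, lie_smul, lie_self, smul_zero, add_zero]
      exact add_mem (add_mem (lie_mem_left ℝ g h _ _ hy)
        (Submodule.smul_mem _ _ (lie_mem_right ℝ g h _ _ hy')))
        (Submodule.smul_mem _ _ (lie_mem_left ℝ g h _ _ hy))
    have hiter (i : ℕ) (w : k) (w' : h) (hw : (w : g) = w') :
        (((LieAlgebra.ad ℝ k ⟨x, y, hy, c, hx⟩ ^ i) w : k) : g) = ((ρ x ^ i) w' : h) := by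
      induction i generalizing w w' with
      | zero => simpa using hw
      | succ i ih =>
        rw [pow_succ, pow_succ, Module.End.mul_apply, Module.End.mul_apply]
        exact ih _ _ (congrArg (fun u => ⁅x, u⁆) hw)
    rw [pow_succ, Module.End.mul_apply, hiter m _ ⟨⁅x, v⁆, hfirst⟩ rfl, hρx, smul_pow, hm]
    simp
  have hle : k ≤ h := hh.2 hk
  exact hW (hle ⟨0, zero_mem _, 1, by simp⟩)

/-- The orthogonal complement of a `J`-invariant subspace of codimension two is spanned by some
unit vector and its image under `J`. -/
theorem IsHermitian.exists_adapted_vector {J : g →ₗ[ℝ] g} {B : LinearMap.BilinForm ℝ g}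
    (hJ : IsHermitian J B) (hmap : ∀ x ∈ h, J x ∈ h) (hcodim : finrank ℝ (g ⧸ h) = 2) :
    ∃ e₁ : g, e₁ ≠ 0 ∧ (∀ y ∈ h, B e₁ y = 0) ∧ (∀ y ∈ h, B (J e₁) y = 0) ∧
      ∀ x, ∃ y ∈ h, ∃ a b : ℝ, x = y + a • e₁ + b • J e₁ := by
  obtain ⟨f, hf⟩ := exists_orthonormal_basis (V := h) (B := B.restrict h.toSubmodule)
    (fun x y => hJ.symm x y) (fun x hx => hJ.pos x fun h0 => hx (Subtype.ext h0))
  obtain ⟨x, hx⟩ : ∃ x, x ∉ h := by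
    by_contra! hall
    have : Subsingleton (g ⧸ h) :=
      Submodule.Quotient.subsingleton_iff.mpr (eq_top_iff.mpr fun v _ => hall v)
    rw [finrank_zero_of_subsingleton] at hcodim
    exact absurd hcodim (by norm_num)
  let p : h := ∑ k, B x (f k) • f k
  let e₁ : g := x - p
  have hne : e₁ ≠ 0 := fun h0 => hx (by rw [sub_eq_zero.mp h0]; exact p.2)
  have h1 (y : g) (hy : y ∈ h) : B e₁ y = 0 := by
    have h2 := sum_bilin_mul_of_orthonormal hf (B x ∘ₗ h.toSubmodule.subtype) ⟨y, hy⟩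
    have h3 : B p y = ∑ k, B y (f k) * B x (f k) := by
      simp only [p]
      rw [hJ.symm]
      have : ((∑ k, B x (f k) • f k : h) : g) = ∑ k, B x (f k) • (f k : g) := by
        simp
      rw [this, map_sum]
      refine Finset.sum_congr rfl fun k _ => ?_
      rw [map_smul, smul_eq_mul, mul_comm]
    rw [map_sub, LinearMap.sub_apply, h3]
    exact sub_eq_zero.mpr h2.symm
  have h2 (y : g) (hy : y ∈ h) : B (J e₁) y = 0 := by
    rw [hJ.skew, h1 _ (hmap y hy), neg_zero]
  refine ⟨e₁, hne, h1, h2, fun v => ?_⟩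
  have h12 : B e₁ (J e₁) = 0 := by
    have := hJ.skew e₁ e₁
    rw [hJ.symm] at this
    linarith
  have hli : LinearIndependent ℝ ![h.toSubmodule.mkQ e₁, h.toSubmodule.mkQ (J e₁)] := by
    rw [LinearIndependent.pair_iff]
    intro s t hst
    rw [← map_smul, ← map_smul, ← map_add, Submodule.mkQ_apply,
      Submodule.Quotient.mk_eq_zero] at hst
    have a1 := h1 _ hst
    have a2 := h2 _ hst
    rw [map_add, map_smul, map_smul, h12, smul_zero, add_zero, smul_eq_mul] at a1
    rw [map_add, map_smul, map_smul, hJ.symm, h12, smul_zero, zero_add, hJ.compatible,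
      smul_eq_mul] at a2
    have hpos := (hJ.pos _ hne).ne'
    exact ⟨(mul_eq_zero.mp a1).resolve_right hpos, (mul_eq_zero.mp a2).resolve_right hpos⟩
  have htop := hli.span_eq_top_of_card_eq_finrank' (by rw [Fintype.card_fin]; exact hcodim.symm)
  have hv : h.toSubmodule.mkQ v ∈ (⊤ : Submodule ℝ (g ⧸ h.toSubmodule)) := trivial
  rw [← htop, Matrix.range_cons, Matrix.range_cons, Matrix.range_empty, Set.union_empty,
    Set.singleton_union, Submodule.mem_span_pair] at hv
  obtain ⟨a, b, hab⟩ := hv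
  refine ⟨v - (a • e₁ + b • J e₁), ?_, a, b, by module⟩
  rw [← map_smul, ← map_smul, ← map_add] at hab
  exact (Submodule.Quotient.eq _).mp hab.symm

end Codimension

/-! ### From generalized Kähler to Kähler -/

section Kahler

variable {g : Type*} [LieRing g] [LieAlgebra ℝ g] {h : LieIdeal ℝ g}

/-- A trilinear alternating form vanishes once it does so on a spanning set of triples adapted to
the decomposition of `g` into a subspace and two further vectors. -/
theorem trilinear_eq_zero_of_span {H : g →ₗ[ℝ] g →ₗ[ℝ] g →ₗ[ℝ] ℝ}
    (hcyc : ∀ x y z, H x y z = H y z x) (hswap : ∀ x y z, H x y z = -H y x z) {e₁ e₂ : g}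
    (hspan : ∀ x, ∃ y ∈ h, ∃ a b : ℝ, x = y + a • e₁ + b • e₂)
    (h0 : ∀ x ∈ h, ∀ y ∈ h, ∀ z ∈ h, H x y z = 0) (h1 : ∀ y ∈ h, ∀ z ∈ h, H e₁ y z = 0)
    (h2 : ∀ y ∈ h, ∀ z ∈ h, H e₂ y z = 0) (h12 : ∀ z ∈ h, H e₁ e₂ z = 0) (x y z : g) :
    H x y z = 0 := by
  have hself (x z : g) : H x x z = 0 := by linarith [hswap x x z]
  have step1 (x : g) (hx : x ∈ h) (y : g) (hy : y ∈ h) (z : g) : H x y z = 0 := by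
    obtain ⟨v, hv, a, b, rfl⟩ := hspan z
    rw [map_add, map_add, map_smul, map_smul, h0 x hx y hy v hv, ← hcyc e₁, ← hcyc e₂,
      h1 x hx y hy, h2 x hx y hy]
    simp
  have step2 (x : g) (hx : x ∈ h) (y z : g) : H x y z = 0 := by
    obtain ⟨v, hv, a, b, rfl⟩ := hspan y
    obtain ⟨w, hw, c, d, rfl⟩ := hspan z
    simp only [map_add, map_smul, LinearMap.add_apply, LinearMap.smul_apply,
      step1 x hx v hv]
    simp only [hcyc x, h1 w hw x hx, h2 w hw x hx, hself, h12 x hx, hswap e₂ e₁ x]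
    simp
  obtain ⟨u, hu, a, b, rfl⟩ := hspan x
  obtain ⟨v, hv, c, d, rfl⟩ := hspan y
  obtain ⟨w, hw, p, q, rfl⟩ := hspan z
  have k1 (x : g) : H e₁ v x = 0 := by rw [hcyc, step2 v hv]
  have k2 (x : g) : H e₂ v x = 0 := by rw [hcyc, step2 v hv]
  have h21 : H e₂ e₁ w = 0 := by rw [hswap, h12 w hw, neg_zero]
  have hlast (x y : g) : H x y x = 0 := by rw [hcyc, hcyc, hself]
  have hlast' (x y : g) : H x y y = 0 := by rw [hcyc, hself]
  simp only [map_add, map_smul, LinearMap.add_apply, LinearMap.smul_apply, step2 u hu,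
    k1, k2, hself, h12 w hw, h21, hlast, hlast', smul_zero, add_zero]

variable {Jp Jm : g →ₗ[ℝ] g} {B : LinearMap.BilinForm ℝ g}

/-- With `J₋ = J₊`, both torsions vanish. -/
theorem IsKahler.isGeneralizedKahler {J : g →ₗ[ℝ] g} (hJ : IsKahler J B) :
    IsGeneralizedKahler J J B := by
  have h0 (x y z : g) : bismutTorsion J B x y z = 0 := hJ.closed _ _ _
  exact ⟨hJ.hermitian, hJ.hermitian, fun x y z => by rw [h0, neg_zero], fun w x y z => by
    simp [extDeriv₃, h0]⟩

variable [FiniteDimensional ℝ g]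

/-- The plane orthogonal to `h` commutes, because `c₊` and `c₋` agree on it and are opposite. The
contraction of `dc₊ = 0` with `J₊` is then a vanishing sum of squares of the remaining components
of `c₊`. -/
theorem IsGeneralizedKahler.isKahler (hh : IsNilradical h) (hcodim : finrank ℝ (g ⧸ h) = 2)
    (hJ : IsGeneralizedKahler Jp Jm B) (hJp : Preserves Jp h) (hJm : Preserves Jm h) :
    IsKahler Jp B := by
  have hp := hJ.hermitian_plus
  have hm := hJ.hermitian_minus
  have hmapp : ∀ x ∈ h, Jp x ∈ h := fun x hx => hJp.map_mem hx
  have hmapm : ∀ x ∈ h, Jm x ∈ h := fun x hx => hJm.map_mem hx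
  have : LieRing.IsNilpotent h := hh.1
  have habel (x : g) (hx : x ∈ h) (y : g) (hy : y ∈ h) : ⁅x, y⁆ = 0 :=
    congrArg Subtype.val ((hJ.restrict hmapp hmapm).lie_eq_zero ⟨x, hx⟩ ⟨y, hy⟩)
  obtain ⟨e₁, hne, ho1, ho2, hspan⟩ := hp.exists_adapted_vector hmapp hcodim
  have hUh : ⁅e₁, Jp e₁⁆ ∈ h := hh.lie_mem_of_codim_two habel hspan
  have ho1' (y : g) (hy : y ∈ h) : B y e₁ = 0 := by rw [hp.symm, ho1 y hy]
  have ho2' (y : g) (hy : y ∈ h) : B y (Jp e₁) = 0 := by rw [hp.symm, ho2 y hy]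
  have hright (x y : g) (hy : y ∈ h) : ⁅x, y⁆ ∈ h := lie_mem_right ℝ g h x y hy
  have hleft (x y : g) (hx : x ∈ h) : ⁅x, y⁆ ∈ h := lie_mem_left ℝ g h x y hx
  -- `Jm` preserves the plane spanned by `e₁` and `Jp e₁`, on which it is a multiple of `Jp`.
  have hJme : ∃ b : ℝ, Jm e₁ = b • Jp e₁ := by
    obtain ⟨y, hy, a, b, hab⟩ := hspan (Jm e₁)
    have hy0 : y = 0 := by
      by_contra hy0
      have h1 := congrArg (fun v => B v y) hab
      simp only [map_add, map_smul, LinearMap.add_apply, LinearMap.smul_apply, ho1 y hy,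
        ho2 y hy, hm.skew, ho1 _ (hmapm y hy)] at h1
      have := hp.pos y hy0
      simp at h1
      linarith
    have hskew0 {J : g →ₗ[ℝ] g} (hh : IsHermitian J B) : B (J e₁) e₁ = 0 := by
      have := hh.skew e₁ e₁
      rw [hh.symm e₁] at this
      linarith
    have ha : a = 0 := by
      have h1 := congrArg (fun v => B v e₁) hab
      simp only [map_add, map_smul, LinearMap.add_apply, LinearMap.smul_apply, hy0, map_zero,
        LinearMap.zero_apply, hskew0 hp, hskew0 hm] at h1
      have := hp.pos e₁ hne
      simpa [this.ne'] using h1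
    exact ⟨b, by rw [hab, hy0, ha]; simp⟩
  obtain ⟨b, hb⟩ := hJme
  have hJmU : ⁅Jm e₁, Jm (Jp e₁)⁆ = ⁅e₁, Jp e₁⁆ := by
    rw [hb, smul_lie, ← lie_smul, ← map_smul, ← hb, hm.complex.sq_eq_neg, lie_neg, lie_skew]
  have hU : ⁅e₁, Jp e₁⁆ = 0 := by
    by_contra hU
    have h1 := hJ.torsion_eq_neg e₁ (Jp e₁) ⁅e₁, Jp e₁⁆
    rw [hp.bismutTorsion_eq, hm.bismutTorsion_eq, hJmU, hp.complex.sq_eq_neg,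
      ho1' _ (hright _ _ (hmapp _ hUh)), ho1' _ (hright _ _ (hmapm _ hUh)),
      ho2' _ (hleft _ _ (hmapp _ hUh)), ho2' _ (hleft _ _ (hmapm _ hUh)), lie_neg, lie_skew] at h1
    linarith [hp.pos _ hU]
  let H := torsionForm Jp B
  let ρ := LieModule.toEnd ℝ g h
  let B' := B.restrict h.toSubmodule
  let j : h →ₗ[ℝ] h := Jp.restrict hmapp
  have hp' : IsHermitian (g := h) j B' := hp.restrict hmapp
  obtain ⟨f, hf⟩ := exists_orthonormal_basis hp'.symm hp'.pos
  let q (e : g) (x y : h) : ℝ := B' (ρ e (j x)) y - B' (ρ e (j y)) x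
  have hH1 (x y : h) : H e₁ x y = -q (Jp e₁) x y := by
    simp only [H, torsionForm_apply]
    rw [habel _ (hmapp _ x.2) _ (hmapp _ y.2), map_zero, LinearMap.zero_apply,
      ← lie_skew (Jp y), map_neg, LinearMap.neg_apply, add_zero, ← sub_eq_add_neg]
    rfl
  have hH2 (x y : h) : H (Jp e₁) x y = q e₁ x y := by
    simp only [H, torsionForm_apply, hp.complex.sq_eq_neg]
    rw [habel _ (hmapp _ x.2) _ (hmapp _ y.2), map_zero, LinearMap.zero_apply, neg_lie, lie_neg,
      ← lie_skew (Jp y), neg_neg, map_neg, LinearMap.neg_apply, add_zero, neg_add, neg_neg,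
      ← sub_eq_add_neg]
    rfl
  have hsum (e : g) := sum_sq_skewPart hf hp'.complex.sq_eq_neg hp'.skew (ρ e) (q := q e)
    fun _ _ => rfl
  -- `dc = 0` on the vectors `e₁, Jp e₁, x, Jp x`.
  have hdc (x : h) : q e₁ (ρ e₁ x) (j x) - q e₁ (ρ e₁ (j x)) x +
      (q (Jp e₁) (ρ (Jp e₁) x) (j x) - q (Jp e₁) (ρ (Jp e₁) (j x)) x) = 0 := by
    have h1 := hJ.torsion_closed e₁ (Jp e₁) x (Jp x)
    simp only [extDeriv₃, ← hp.torsionForm_apply_eq] at h1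
    rw [hU, habel _ x.2 _ (hmapp _ x.2)] at h1
    have s (a b c : g) : torsionForm Jp B a b c = -H b a c := torsionForm_swap a b c
    rw [s ⁅e₁, (x : g)⁆, s ⁅e₁, Jp x⁆, s ⁅Jp e₁, (x : g)⁆, s ⁅Jp e₁, Jp x⁆] at h1
    have a1 := hH2 (ρ e₁ x) (j x)
    have a2 := hH2 (ρ e₁ (j x)) x
    have a3 := hH1 (ρ (Jp e₁) x) (j x)
    have a4 := hH1 (ρ (Jp e₁) (j x)) x
    change H (Jp e₁) ⁅e₁, (x : g)⁆ (Jp x) = _ at a1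
    change H (Jp e₁) ⁅e₁, Jp x⁆ x = _ at a2
    change H e₁ ⁅Jp e₁, (x : g)⁆ (Jp x) = _ at a3
    change H e₁ ⁅Jp e₁, Jp x⁆ x = _ at a4
    rw [a1, a2, a3, a4] at h1
    simp only [map_zero, LinearMap.zero_apply] at h1
    linarith
  have htot : ∑ k, ∑ l, (q e₁ (f k) (f l) ^ 2 + q (Jp e₁) (f k) (f l) ^ 2) = 0 := by
    simp only [Finset.sum_add_distrib, hsum]
    rw [← Finset.sum_add_distrib]
    exact Finset.sum_eq_zero fun k _ => hdc (f k)
  have hq (k l) : q e₁ (f k) (f l) = 0 ∧ q (Jp e₁) (f k) (f l) = 0 := by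
    have nn (k l) : 0 ≤ q e₁ (f k) (f l) ^ 2 + q (Jp e₁) (f k) (f l) ^ 2 := by positivity
    rw [Finset.sum_eq_zero_iff_of_nonneg fun k _ => Finset.sum_nonneg fun l _ => nn k l] at htot
    have h1 := htot k (Finset.mem_univ k)
    rw [Finset.sum_eq_zero_iff_of_nonneg fun l _ => nn k l] at h1
    have h2 := h1 l (Finset.mem_univ l)
    constructor <;> nlinarith [sq_nonneg (q e₁ (f k) (f l)), sq_nonneg (q (Jp e₁) (f k) (f l))]
  have hzero (e : g) (he : ∀ k l, H e (f k) (f l) = 0) (x : g) (hx : x ∈ h) (y : g) (hy : y ∈ h) :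
      H e x y = 0 := by
    have : (H e).domRestrict₁₂ h.toSubmodule h.toSubmodule = 0 :=
      f.ext fun k => f.ext fun l => he k l
    exact LinearMap.congr_fun₂ this ⟨x, hx⟩ ⟨y, hy⟩
  have hH (x y z : g) : H x y z = 0 := by
    refine trilinear_eq_zero_of_span torsionForm_cyclic torsionForm_swap hspan ?_
      (hzero e₁ fun k l => by rw [hH1, (hq k l).2, neg_zero])
      (hzero (Jp e₁) fun k l => by rw [hH2, (hq k l).1]) ?_ x y z
    · intro x hx y hy z hz
      simp [torsionForm_apply, habel _ (hmapp x hx) _ (hmapp y hy),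
        habel _ (hmapp y hy) _ (hmapp z hz), habel _ (hmapp z hz) _ (hmapp x hx)]
    · intro z hz
      simp only [torsionForm_apply, hp.complex.sq_eq_neg]
      rw [lie_neg, lie_skew, hU, ho1' _ (hright _ _ (hmapp _ hz)),
        ho2' _ (hleft _ _ (hmapp _ hz))]
      simp
  refine ⟨hp, fun x y z => ?_⟩
  have h1 := hH (Jp x) (Jp y) (Jp z)
  simp only [H, hp.torsionForm_apply_eq, bismutTorsion, hp.complex.sq_eq_neg] at h1
  simp only [extDeriv₂, fundamentalForm, lie_neg, neg_lie, map_neg, neg_neg] at h1 ⊢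
  linarith

end Kahler

end LieHermitian

theorem theorem2p7 {g : Type*} [LieRing g] [LieAlgebra ℝ g] [FiniteDimensional ℝ g]
    [LieAlgebra.IsSolvable g] (h : LieIdeal ℝ g) (hh : LieHermitian.IsNilradical h)
    (hcodim : Module.finrank ℝ (g ⧸ h) = 2) :
    ((∃ (Jp Jm : g →ₗ[ℝ] g) (B : LinearMap.BilinForm ℝ g),
        LieHermitian.IsGeneralizedKahler Jp Jm B ∧
          LieHermitian.Preserves Jp h ∧ LieHermitian.Preserves Jm h) ↔
      ∃ (Jp : g →ₗ[ℝ] g) (B : LinearMap.BilinForm ℝ g),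
        LieHermitian.IsKahler Jp B ∧ LieHermitian.Preserves Jp h) ∧
    ∀ (Jp : g →ₗ[ℝ] g) (B : LinearMap.BilinForm ℝ g),
      (∃ Jm : g →ₗ[ℝ] g, LieHermitian.IsGeneralizedKahler Jp Jm B ∧
          LieHermitian.Preserves Jp h ∧ LieHermitian.Preserves Jm h) ↔
        (LieHermitian.IsKahler Jp B ∧ LieHermitian.Preserves Jp h) := by
  have key (Jp : g →ₗ[ℝ] g) (B : LinearMap.BilinForm ℝ g) :
      (∃ Jm : g →ₗ[ℝ] g, LieHermitian.IsGeneralizedKahler Jp Jm B ∧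
          LieHermitian.Preserves Jp h ∧ LieHermitian.Preserves Jm h) ↔
        (LieHermitian.IsKahler Jp B ∧ LieHermitian.Preserves Jp h) :=
    ⟨fun ⟨_, hJ, hp, hm⟩ => ⟨hJ.isKahler hh hcodim hp hm, hp⟩,
      fun ⟨hJ, hp⟩ => ⟨Jp, hJ.isGeneralizedKahler, hp, hp⟩⟩
  refine ⟨⟨fun ⟨Jp, Jm, B, hJ⟩ => ⟨Jp, B, (key Jp B).mp ⟨Jm, hJ⟩⟩, fun ⟨Jp, B, hJ⟩ => ?_⟩, key⟩
  obtain ⟨Jm, hJm⟩ := (key Jp B).mpr hJ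
  exact ⟨Jp, Jm, B, hJm⟩
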